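/- Let $K, A, B$ be nonempty finite sets (states, actions of player 1, actions of player 2), let $M_k \in \mathbb{R}^{|A|\times|B|}$ for $k \in K$ be payoff matrices, and let $Q_a \in \mathbb{R}^{|K|\times|K|}$ for $a \in A$ be row-stochastic transition matrices. Let $N \ge 1$ and $\alpha \in \mathbb{R}^{|K|}$. In the $N$-stage dual game $G_N(\alpha)$, player 1 (the informed player) draws the initial state $k_1$ from a distribution $p \in \Delta(K)$ of his choice; at each later stage $t$ the state $k_t$ has law $Q_{a_{t-1}}(k_{t-1},\cdot)$. At each stage $t=1,\dots,N$ only player 1 observes $k_t$, both players simultaneously choose actions $a_t \in A$ and $b_t \in B$, and these actions are then observed by both. A strategy of player 1 is a pair $(p,\sigma)$ with $p\in\Delta(K)$ and $\sigma = (\sigma_t)_{t=1}^N \in \Sigma_N$, $\sigma_t : K^t \times A^{t-1} \times B^{t-1} \to \Delta(A)$; a strategy of player 2 (the uninformed player) is $\tau = (\tau_t)_{t=1}^N \in \mathcal{T}_N$, $\tau_t : A^{t-1}\times B^{t-1} \to \Delta(B)$. The payoff to player 1, which is the cost to player 2, is $$g_N(\alpha,p,\sigma,\tau) = \mathbf{E}_{p,\sigma,\tau,Q}\Big(\alpha(k_1)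 + \sum_{t=1}^N M_{k_t}(a_t,b_t)\Big).$$ A strategy $\tau^*$ of player 2 is a security strategy in $G_N(\alpha)$ if $$\max_{p \in \Delta(K),\, \sigma \in \Sigma_N} g_N(\alpha,p,\sigma,\tau^*) = \min_{\tau \in \mathcal{T}_N}\ \max_{p \in \Delta(K),\, \sigma \in \Sigma_N} g_N(\alpha,p,\sigma,\tau),$$ where the maxima and the minimum exist. Then player 2 has a security strategy $\tau^*$ in $G_N(\alpha)$ that, at each stage $t$, depends only on $t$ and on the action history $I_t = (a_1,\dots,a_{t-1})$ of player 1; that is, $\tau^*_t(I_t, J_t) = \tau^*_t(I_t, J'_t)$ for all $t\in\{1,\dots,N\}$, $I_t \in A^{t-1}$ and $J_t, J'_t \in B^{t-1}$. -/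

import Mathlib

/-- The data `(K, A, B, M, Q)` shared by an asymmetric information stochastic game and its dual
game: `payoff k a b` is the one-stage payoff `M_k(a, b)` to player 1 (the informed player), and
`transition a k` is the probability vector `Q_a(k, ·)` of the next state. -/
structure StochasticGame (K A B : Type*) [Fintype K] where
  payoff : K → Matrix A B ℝ
  transition : A → K → stdSimplex ℝ K

namespace StochasticGame

/-- Behavior strategies of the informed player: at stage `t` (stages are numbered from `0`), a
mixed action as a function of the states up to and including stage `t`, and of the past actions
of both players. -/
abbrev InformedStrategy (K A B : Type*) [Fintype A] (N : ℕ) :=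
  (t : Fin N) → (Fin (t + 1) → K) → (Fin t → A) → (Fin t → B) → stdSimplex ℝ A

/-- Behavior strategies of the uninformed player: at stage `t`, a mixed action as a function of
the past actions of both players. -/
abbrev UninformedStrategy (A B : Type*) [Fintype B] (N : ℕ) :=
  (t : Fin N) → (Fin t → A) → (Fin t → B) → stdSimplex ℝ B

/-- At every stage, the strategy uses only the stage and the past actions of the informed player:
the past actions of the uninformed player himself are irrelevant. -/
def UninformedStrategy.DependsOnlyOnInformedActions {A B : Type*} [Fintype B] {N : ℕ}
    (τ : UninformedStrategy A B N) : Prop :=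
  ∀ (t : Fin N) (I : Fin t → A) (J J' : Fin t → B), τ t I J = τ t I J'

/-- A play: the state, the action of player 1 and the action of player 2 at each stage. -/
abbrev Play (K A B : Type*) (N : ℕ) := Fin N → K × A × B

section Play

variable {K A B : Type*} {N : ℕ}

def Play.state (ω : Play K A B N) (t : Fin N) : K := (ω t).1

def Play.action₁ (ω : Play K A B N) (t : Fin N) : A := (ω t).2.1

def Play.action₂ (ω : Play K A B N) (t : Fin N) : B := (ω t).2.2

/-- The states up to and including stage `t`. -/
def Play.states (ω : Play K A B N) (t : Fin N) : Fin (t + 1) → K :=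
  fun s => ω.state (Fin.castLE t.isLt s)

/-- The actions of player 1 strictly before stage `t`. -/
def Play.actions₁ (ω : Play K A B N) (t : Fin N) : Fin t → A :=
  fun s => ω.action₁ (Fin.castLE t.isLt.le s)

/-- The actions of player 2 strictly before stage `t`. -/
def Play.actions₂ (ω : Play K A B N) (t : Fin N) : Fin t → B :=
  fun s => ω.action₂ (Fin.castLE t.isLt.le s)

end Play

noncomputable section

variable {K A B : Type*} [Fintype K] [Fintype A] [Fintype B] {N : ℕ}

/-- The conditional probability of the state at stage `t` given the past: the initial
distribution `p` at the first stage, and the transition law afterwards. -/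
def stateProb (G : StochasticGame K A B) (p : stdSimplex ℝ K) (ω : Play K A B N)
    (t : Fin N) : ℝ :=
  if (t : ℕ) = 0 then p.1 (ω.state t)
  else
    let s : Fin N := ⟨t - 1, (Nat.sub_le _ _).trans_lt t.isLt⟩
    (G.transition (ω.action₁ s) (ω.state s)).1 (ω.state t)

/-- The probability of the play `ω` induced by the initial distribution `p`, the strategies
`σ` and `τ`, and the transition law. The players randomize independently at each stage. -/
def playProb (G : StochasticGame K A B) (p : stdSimplex ℝ K) (σ : InformedStrategy K A B N)
    (τ : UninformedStrategy A B N) (ω : Play K A B N) : ℝ :=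
  ∏ t : Fin N, G.stateProb p ω t *
    (σ t (ω.states t) (ω.actions₁ t) (ω.actions₂ t)).1 (ω.action₁ t) *
    (τ t (ω.actions₁ t) (ω.actions₂ t)).1 (ω.action₂ t)

/-- The total payoff to player 1 in the `N`-stage dual game with initial vector payoff `α`, when
player 1 draws the initial state from `p` and plays `σ`, and player 2 plays `τ`: the expectation
of `α (k₁) + ∑ t, M_{k_t} (a_t, b_t)`. -/
def dualPayoff [NeZero N] (G : StochasticGame K A B) (α : K → ℝ) (p : stdSimplex ℝ K)
    (σ : InformedStrategy K A B N) (τ : UninformedStrategy A B N) : ℝ :=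
  ∑ ω : Play K A B N, G.playProb p σ τ ω *
    (α (ω.state 0) + ∑ t : Fin N, G.payoff (ω.state t) (ω.action₁ t) (ω.action₂ t))

/-- `u = max_{p, σ} g_N(α, p, σ, τ)`: the maximum exists and equals `u`. -/
def IsWorstCost [NeZero N] (G : StochasticGame K A B) (α : K → ℝ)
    (τ : UninformedStrategy A B N) (u : ℝ) : Prop :=
  IsGreatest (Set.range fun x : stdSimplex ℝ K × InformedStrategy K A B N =>
    G.dualPayoff α x.1 x.2 τ) u

/-- `w = min_τ max_{p, σ} g_N(α, p, σ, τ)`: the minimum exists and equals `w`. This is the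
security level of player 2 in the `N`-stage dual game. -/
def IsDualSecurityLevel (N : ℕ) [NeZero N] (G : StochasticGame K A B) (α : K → ℝ)
    (w : ℝ) : Prop :=
  IsLeast {u : ℝ | ∃ τ : UninformedStrategy A B N, G.IsWorstCost α τ u} w

/-- `τ` guarantees the security level of player 2 in the dual game: the maximum over `(p, σ)` of
the payoff against `τ` is equal to that level. -/
def IsDualSecurityStrategy [NeZero N] (G : StochasticGame K A B) (α : K → ℝ)
    (τ : UninformedStrategy A B N) : Prop :=
  ∃ w : ℝ, IsDualSecurityLevel N G α w ∧ G.IsWorstCost α τ w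

end

end StochasticGame

namespace StochasticGame

/-! Transitions depend only on player 1's actions, and the payoff is a sum of terms each involving a
single action of player 2. So with the states `k` and actions `I` of player 1 fixed, only the law of
each `b_t` matters, not the joint law of `J`. Take an optimal `τ`, which exists by compactness, and
replace it by `marginal τ`.

Against `marginal τ`, conditioning player 1's mixed actions on `J` gains nothing: the mean payoff is
a function of `k` and `I`, and `exists_strategy_ignoring_uninformed` reproduces the law of `(k, I)`
without `J`. Such a reply earns the same against `τ` as against `marginal τ`. Hence the worst cost
of `marginal τ` is at most that of `τ`, so it is optimal too (`exists_dualPayoff_eq`). -/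

/-- The terms of the sequence `x` strictly before `t`. -/
def past {X : Type*} {N : ℕ} (x : Fin N → X) (t : Fin N) : Fin t → X :=
  fun s => x (Fin.castLE t.isLt.le s)

/-- The terms of the sequence `x` up to and including `t`. -/
def upTo {X : Type*} {N : ℕ} (x : Fin N → X) (t : Fin N) : Fin (t + 1) → X :=
  fun s => x (Fin.castLE t.isLt s)

/-! ### Finite sequences generated by kernels. -/

section Sequences

variable {X : Type*} [Fintype X] {N : ℕ}

/-- The weight of a sequence generated term by term from the transition kernels `f`. -/
def seqProb (f : (t : Fin N) → (Fin t → X) → X → ℝ) (x : Fin N → X) : ℝ :=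
  ∏ t : Fin N, f t (past x t) (x t)

omit [Fintype X] in
theorem past_snoc_last (x : Fin N → X) (y : X) :
    past (Fin.snoc x y : Fin (N + 1) → X) (Fin.last N) = x := by
  funext s
  exact Fin.snoc_castSucc (α := fun _ => X) y x s

omit [Fintype X] in
theorem past_snoc_castSucc (x : Fin N → X) (y : X) (t : Fin N) :
    past (Fin.snoc x y : Fin (N + 1) → X) t.castSucc = past x t := by
  funext s
  exact Fin.snoc_castSucc (α := fun _ => X) y x (Fin.castLE t.isLt.le s)

omit [Fintype X] in
theorem seqProb_snoc (f : (t : Fin (N + 1)) → (Fin t → X) → X → ℝ) (x : Fin N → X) (y : X) :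
    seqProb f (Fin.snoc x y) =
      seqProb (fun t : Fin N => f t.castSucc) x * f (Fin.last N) x y := by
  simp only [seqProb, Fin.prod_univ_castSucc, past_snoc_castSucc, past_snoc_last,
    Fin.snoc_castSucc, Fin.snoc_last]

theorem sum_seq_succ (F : (Fin (N + 1) → X) → ℝ) :
    ∑ x, F x = ∑ x : Fin N → X, ∑ y, F (Fin.snoc x y) := by
  rw [← (Fin.snocEquiv fun _ : Fin (N + 1) => X).sum_comp, Fintype.sum_prod_type_right]
  rfl

theorem sum_seqProb (f : (t : Fin N) → (Fin t → X) → X → ℝ)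
    (hf : ∀ t h, ∑ y, f t h y = 1) : ∑ x, seqProb f x = 1 := by
  induction N with
  | zero => simp [seqProb]
  | succ N ih =>
    simp only [sum_seq_succ, seqProb_snoc, ← Finset.mul_sum, hf, mul_one]
    exact ih _ fun t h => hf t.castSucc h

/-- The law of the first `t + 1` terms of the sequence depends on the first kernels only. -/
theorem sum_seqProb_mul (f : (t : Fin N) → (Fin t → X) → X → ℝ)
    (hf : ∀ t h, ∑ y, f t h y = 1) (t : Fin N) (φ : (Fin t → X) → X → ℝ) :
    ∑ x, seqProb f x * φ (past x t) (x t) =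
      ∑ h : Fin t → X, seqProb (fun s : Fin t => f (s.castLE t.isLt.le)) h *
        ∑ y, f t h y * φ h y := by
  induction N with
  | zero => exact t.elim0
  | succ N ih =>
    simp only [sum_seq_succ, seqProb_snoc]
    induction t using Fin.lastCases with
    | last =>
      refine Finset.sum_congr rfl fun x _ => ?_
      rw [Finset.mul_sum]
      refine Finset.sum_congr rfl fun y _ => ?_
      rw [past_snoc_last, Fin.snoc_last, mul_assoc]
      rfl
    | cast t =>
      simp only [past_snoc_castSucc, Fin.snoc_castSucc, mul_right_comm _ (f (Fin.last N) _ _),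
        ← Finset.mul_sum, hf, mul_one]
      exact ih (fun t => f t.castSucc) (fun t h => hf t.castSucc h) t φ

end Sequences

theorem exists_stdSimplex_mix {ι A : Type*} [Fintype ι] [Fintype A] [Nonempty A]
    (w : ι → ℝ) (hw : ∀ i, 0 ≤ w i) (v : ι → stdSimplex ℝ A) :
    ∃ m : stdSimplex ℝ A, ∀ a, (∑ i, w i) * m.1 a = ∑ i, w i * (v i).1 a := by
  classical
  by_cases h : ∑ i, w i = 0
  · have h0 : ∀ i, w i = 0 := fun i =>
      (Finset.sum_eq_zero_iff_of_nonneg fun i _ => hw i).1 h i (Finset.mem_univ i)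
    exact ⟨⟨_, single_mem_stdSimplex ℝ (Classical.arbitrary A)⟩, fun a => by simp [h0]⟩
  · refine ⟨⟨fun a => (∑ i, w i)⁻¹ * ∑ i, w i * (v i).1 a, fun a => ?_, ?_⟩, fun a => ?_⟩
    · exact mul_nonneg (inv_nonneg.2 (Finset.sum_nonneg fun i _ => hw i))
        (Finset.sum_nonneg fun i _ => mul_nonneg (hw i) ((v i).2.1 a))
    · rw [← Finset.mul_sum, Finset.sum_comm]
      simp only [← Finset.mul_sum, (v _).2.2, mul_one]
      exact inv_mul_cancel₀ h
    · exact mul_inv_cancel_left₀ h _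

section Game

variable {K A B : Type*} [Fintype A] [Fintype B] {N : ℕ}

/-- Against an opponent whose actions do not depend on his own past actions, the past actions of
the opponent can be averaged out of a behavior strategy. -/
theorem exists_strategy_ignoring_uninformed [Nonempty A] (σ : InformedStrategy K A B N)
    (ρ : (t : Fin N) → (Fin t → A) → stdSimplex ℝ B) :
    ∃ σ' : (t : Fin N) → (Fin (t + 1) → K) → (Fin t → A) → stdSimplex ℝ A,
      ∀ (k : Fin N → K) (I : Fin N → A),
        ∏ t, (σ' t (upTo k t) (past I t)).1 (I t) =
          ∑ J, seqProb (fun t h b => (σ t (upTo k t) (past I t) h).1 (I t) *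
            (ρ t (past I t)).1 b) J := by
  induction N with
  | zero => exact ⟨fun t => t.elim0, fun k I => by simp [seqProb]⟩
  | succ N ih =>
    obtain ⟨σ', h'⟩ := ih (fun t => σ t.castSucc) (fun t => ρ t.castSucc)
    -- `m` is the conditional law of the last action given the states and `I`: the average of `σ`
    -- over `J`, weighted by the joint probability of `I` and `J` along the states.
    choose m hm using fun (ks : Fin (N + 1) → K) (I : Fin N → A) =>
      exists_stdSimplex_mix (fun J : Fin N → B =>
        seqProb (fun t h b => (σ t.castSucc (upTo (fun s => ks s.castSucc) t) (past I t) h).1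
          (I t) * (ρ t.castSucc (past I t)).1 b) J)
        (fun J => Finset.prod_nonneg fun t _ => mul_nonneg ((σ _ _ _ _).2.1 _) ((ρ _ _).2.1 _))
        (fun J => σ (Fin.last N) ks I J)
    refine ⟨fun t => Fin.lastCases (motive := fun t : Fin (N + 1) =>
      (Fin (t + 1) → K) → (Fin t → A) → stdSimplex ℝ A) m σ' t, fun k I => ?_⟩
    rw [Fin.prod_univ_castSucc]
    simp only [Fin.lastCases_last, Fin.lastCases_castSucc, sum_seq_succ, seqProb_snoc,
      ← Finset.mul_sum, (ρ _ _).2.2, mul_one]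
    refine Eq.trans ?_ (hm k (fun s => I s.castSucc) (I (Fin.last N)))
    congr 1
    exact h' (fun s => k s.castSucc) (fun s => I s.castSucc)

end Game

end StochasticGame
namespace StochasticGame

section Play

theorem upTo_eq_snoc {X : Type*} {N : ℕ} (x : Fin N → X) (t : Fin N) :
    (Fin.snoc (past x t) (x t) : Fin (t + 1) → X) = upTo x t := by
  funext s
  induction s using Fin.lastCases with
  | last => simp only [Fin.snoc_last]; rfl
  | cast s => simp only [Fin.snoc_castSucc]; rfl

theorem sum_play {K A B : Type*} [Fintype K] [Fintype A] [Fintype B] {N : ℕ}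
    (F : Play K A B N → ℝ) :
    ∑ ω, F ω = ∑ k : Fin N → K, ∑ I : Fin N → A, ∑ J : Fin N → B,
      F fun t => (k t, I t, J t) := by
  rw [← (Equiv.arrowProdEquivProdArrow (Fin N) (fun _ => K) fun _ => A × B).symm.sum_comp,
    Fintype.sum_prod_type]
  refine Finset.sum_congr rfl fun k _ => ?_
  rw [← (Equiv.arrowProdEquivProdArrow (Fin N) (fun _ => A) fun _ => B).symm.sum_comp,
    Fintype.sum_prod_type]
  rfl

end Play

/-! ### Expected payoffs and the marginal strategy. -/

noncomputable section

variable {K A B : Type*} [Fintype K] [Fintype A] [Fintype B] {N : ℕ}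

/-- The law of the state at stage `t` given the earlier stages of the play. -/
def nextState (G : StochasticGame K A B) (p : stdSimplex ℝ K) (t : Fin N)
    (h : Fin t → K × A × B) : stdSimplex ℝ K :=
  if ht : (t : ℕ) = 0 then p
  else
    let s : Fin t := ⟨t - 1, Nat.sub_lt (Nat.pos_of_ne_zero ht) one_pos⟩
    G.transition (h s).2.1 (h s).1

/-- The law of the stage `t` of the play given the earlier stages. -/
def playKernel (G : StochasticGame K A B) (p : stdSimplex ℝ K) (σ : InformedStrategy K A B N)
    (τ : UninformedStrategy A B N) (t : Fin N) (h : Fin t → K × A × B) (x : K × A × B) : ℝ :=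
  (G.nextState p t h).1 x.1 *
    ((σ t (Fin.snoc (fun s => (h s).1) x.1) (fun s => (h s).2.1) fun s => (h s).2.2).1 x.2.1 *
      (τ t (fun s => (h s).2.1) fun s => (h s).2.2).1 x.2.2)

theorem sum_playKernel (G : StochasticGame K A B) (p : stdSimplex ℝ K)
    (σ : InformedStrategy K A B N) (τ : UninformedStrategy A B N) (t : Fin N)
    (h : Fin t → K × A × B) : ∑ x, G.playKernel p σ τ t h x = 1 := by
  simp only [playKernel, Fintype.sum_prod_type, ← Finset.mul_sum, (τ _ _ _).2.2,
    (σ _ _ _ _).2.2, mul_one, (G.nextState p t h).2.2]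

theorem playProb_eq_seqProb (G : StochasticGame K A B) (p : stdSimplex ℝ K)
    (σ : InformedStrategy K A B N) (τ : UninformedStrategy A B N) (ω : Play K A B N) :
    G.playProb p σ τ ω = seqProb (G.playKernel p σ τ) ω := by
  refine Finset.prod_congr rfl fun t _ => ?_
  have hs : G.stateProb p ω t = (G.nextState p t (past ω t)).1 (ω t).1 := by
    unfold stateProb nextState
    split_ifs <;> rfl
  rw [playKernel, ← mul_assoc, hs]
  have hk : (Fin.snoc (fun s => (past ω t s).1) (ω t).1 : Fin (t + 1) → K) = ω.states t :=
    upTo_eq_snoc ω.state t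
  rw [hk]
  rfl

/-- Player 1's stage payoff may be replaced by its mean over the current action of player 2. -/
theorem sum_playProb_payoff (G : StochasticGame K A B) (p : stdSimplex ℝ K)
    (σ : InformedStrategy K A B N) (ρ : (t : Fin N) → (Fin t → A) → stdSimplex ℝ B)
    (t : Fin N) :
    ∑ ω, G.playProb p σ (fun t I _ => ρ t I) ω *
        G.payoff (ω.state t) (ω.action₁ t) (ω.action₂ t) =
      ∑ ω, G.playProb p σ (fun t I _ => ρ t I) ω *
        ∑ b, (ρ t (ω.actions₁ t)).1 b * G.payoff (ω.state t) (ω.action₁ t) b := by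
  simp only [playProb_eq_seqProb]
  have key := sum_seqProb_mul (G.playKernel p σ fun t I _ => ρ t I)
    (G.sum_playKernel p σ fun t I _ => ρ t I) t
  refine (key fun _ x => G.payoff x.1 x.2.1 x.2.2).trans (Eq.trans ?_ (key fun h x =>
    ∑ b, (ρ t fun s => (h s).2.1).1 b * G.payoff x.1 x.2.1 b).symm)
  refine Finset.sum_congr rfl fun h _ => ?_
  congr 1
  simp only [playKernel, Fintype.sum_prod_type]
  refine Finset.sum_congr rfl fun k _ => Finset.sum_congr rfl fun a _ => ?_
  rw [← Finset.sum_mul, ← Finset.mul_sum, ← Finset.mul_sum, (ρ _ _).2.2, mul_one]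
  simp only [mul_assoc, Finset.mul_sum]

/-- The product of the transition probabilities along the states `k`, for the actions `I` of
player 1. -/
def pathProb (G : StochasticGame K A B) (p : stdSimplex ℝ K) (k : Fin N → K)
    (I : Fin N → A) : ℝ :=
  ∏ t : Fin N, if (t : ℕ) = 0 then p.1 (k t)
    else
      let s : Fin N := ⟨t - 1, (Nat.sub_le _ _).trans_lt t.isLt⟩
      (G.transition (I s) (k s)).1 (k t)

/-- The transition factor comes out free of `J` because player 2's actions do not influence the
state. -/
theorem playProb_mk (G : StochasticGame K A B) (p : stdSimplex ℝ K)
    (σ : InformedStrategy K A B N) (τ : UninformedStrategy A B N) (k : Fin N → K)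
    (I : Fin N → A) (J : Fin N → B) :
    G.playProb p σ τ (fun t => (k t, I t, J t)) = G.pathProb p k I *
      seqProb (fun t h b => (σ t (upTo k t) (past I t) h).1 (I t) *
        (τ t (past I t) h).1 b) J := by
  simp only [playProb, pathProb, seqProb, mul_assoc, ← Finset.prod_mul_distrib]
  rfl

/-- The total payoff along `k` and `I`, averaged over the actions of player 2. -/
def meanPayoff [NeZero N] (G : StochasticGame K A B) (α : K → ℝ)
    (ρ : (t : Fin N) → (Fin t → A) → stdSimplex ℝ B) (k : Fin N → K) (I : Fin N → A) : ℝ :=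
  α (k 0) + ∑ t, ∑ b, (ρ t (past I t)).1 b * G.payoff (k t) (I t) b

theorem dualPayoff_ignoring_own_actions [NeZero N] (G : StochasticGame K A B) (α : K → ℝ)
    (p : stdSimplex ℝ K) (σ : InformedStrategy K A B N)
    (ρ : (t : Fin N) → (Fin t → A) → stdSimplex ℝ B) :
    G.dualPayoff α p σ (fun t I _ => ρ t I) = ∑ k, ∑ I, G.pathProb p k I *
      (∑ J, seqProb (fun t h b => (σ t (upTo k t) (past I t) h).1 (I t) *
        (ρ t (past I t)).1 b) J) * G.meanPayoff α ρ k I := by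
  have h : G.dualPayoff α p σ (fun t I _ => ρ t I) =
      ∑ ω, G.playProb p σ (fun t I _ => ρ t I) ω *
        G.meanPayoff α ρ ω.state ω.action₁ := by
    simp only [dualPayoff, meanPayoff, mul_add, Finset.sum_add_distrib]
    congr 1
    simp only [Finset.mul_sum (s := (Finset.univ : Finset (Fin N)))]
    rw [Finset.sum_comm, Finset.sum_comm (t := (Finset.univ : Finset (Fin N)))]
    exact Finset.sum_congr rfl fun t _ => G.sum_playProb_payoff p σ ρ t
  rw [h, sum_play]
  simp only [playProb_mk, Finset.mul_sum, Finset.sum_mul]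
  rfl

/-- The law of the current action of player 2 given the past actions of player 1 only. -/
def marginal (τ : UninformedStrategy A B N) (t : Fin N) (I : Fin t → A) : stdSimplex ℝ B :=
  ⟨fun b => ∑ J : Fin t → B,
    seqProb (fun s h b => (τ (s.castLE t.isLt.le) (past I s) h).1 b) J * (τ t I J).1 b,
    fun _ => Finset.sum_nonneg fun _ _ => mul_nonneg
      (Finset.prod_nonneg fun _ _ => (τ _ _ _).2.1 _) ((τ _ _ _).2.1 _), by
    rw [Finset.sum_comm]
    simp only [← Finset.mul_sum, (τ _ _ _).2.2, mul_one]
    exact sum_seqProb _ fun s h => (τ _ _ _).2.2⟩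

omit [Fintype A] in
theorem sum_seqProb_uninformed (τ : UninformedStrategy A B N) (I : Fin N → A) (t : Fin N)
    (φ : B → ℝ) :
    ∑ J, seqProb (fun t h b => (τ t (past I t) h).1 b) J * φ (J t) =
      ∑ b, (marginal τ t (past I t)).1 b * φ b := by
  refine (sum_seqProb_mul _ (fun t h => (τ t (past I t) h).2.2) t fun _ b => φ b).trans ?_
  simp only [marginal, Finset.sum_mul, Finset.mul_sum, mul_assoc]
  exact Finset.sum_comm

/-- The factors of `σ` do not involve `J`, so for fixed `k` and `I` the sum over `J` runs over
player 2's law alone. By linearity each stage payoff then sees only the marginal of `b_t`. -/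
theorem dualPayoff_against_ignoring [NeZero N] (G : StochasticGame K A B) (α : K → ℝ)
    (p : stdSimplex ℝ K) (σ : (t : Fin N) → (Fin (t + 1) → K) → (Fin t → A) → stdSimplex ℝ A)
    (τ : UninformedStrategy A B N) :
    G.dualPayoff α p (fun t k I _ => σ t k I) τ = ∑ k, ∑ I, G.pathProb p k I *
      (∏ t, (σ t (upTo k t) (past I t)).1 (I t)) * G.meanPayoff α (marginal τ) k I := by
  rw [dualPayoff, sum_play]
  refine Finset.sum_congr rfl fun k _ => Finset.sum_congr rfl fun I _ => ?_
  have h : ∀ J : Fin N → B, seqProb (fun t h b => (σ t (upTo k t) (past I t)).1 (I t) *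
      (τ t (past I t) h).1 b) J = (∏ t, (σ t (upTo k t) (past I t)).1 (I t)) *
        seqProb (fun t h b => (τ t (past I t) h).1 b) J := fun J => Finset.prod_mul_distrib
  simp only [playProb_mk, h, mul_assoc, ← Finset.mul_sum]
  congr 2
  have h₁ : ∑ J, seqProb (fun t h b => (τ t (past I t) h).1 b) J = 1 :=
    sum_seqProb _ fun t h => (τ t (past I t) h).2.2
  simp only [Play.state, Play.action₁, Play.action₂, meanPayoff, mul_add,
    Finset.sum_add_distrib, ← sum_seqProb_uninformed]
  rw [← Finset.sum_mul, h₁, one_mul]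
  simp only [Finset.mul_sum]
  rw [Finset.sum_comm]

/-- Whatever player 1 obtains against the marginals of `τ`, he can obtain against `τ`. -/
theorem exists_dualPayoff_eq [NeZero N] [Nonempty A] (G : StochasticGame K A B) (α : K → ℝ)
    (p : stdSimplex ℝ K) (σ : InformedStrategy K A B N) (τ : UninformedStrategy A B N) :
    ∃ σ' : InformedStrategy K A B N,
      G.dualPayoff α p σ (fun t I _ => marginal τ t I) = G.dualPayoff α p σ' τ := by
  obtain ⟨σ', h⟩ := exists_strategy_ignoring_uninformed σ (marginal τ)
  refine ⟨fun t k I _ => σ' t k I, ?_⟩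
  simp only [dualPayoff_ignoring_own_actions, dualPayoff_against_ignoring, h]

omit [Fintype A] [Fintype B] in
theorem continuous_stdSimplex_apply (k : K) : Continuous fun m : stdSimplex ℝ K => m.1 k :=
  (continuous_apply k).comp continuous_subtype_val

theorem continuous_dualPayoff [NeZero N] (G : StochasticGame K A B) (α : K → ℝ) :
    Continuous fun x : UninformedStrategy A B N × stdSimplex ℝ K × InformedStrategy K A B N =>
      G.dualPayoff α x.2.1 x.2.2 x.1 := by
  refine continuous_finsetSum _ fun ω _ => Continuous.mul ?_ continuous_const
  refine continuous_finsetProd _ fun t _ => (Continuous.mul ?_ ?_).mul ?_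
  · unfold stateProb
    split_ifs
    · exact (continuous_stdSimplex_apply _).comp continuous_snd.fst
    · exact continuous_const
  · have h : Continuous fun x : UninformedStrategy A B N × stdSimplex ℝ K ×
        InformedStrategy K A B N => x.2.2 t (ω.states t) (ω.actions₁ t) (ω.actions₂ t) := by
      fun_prop
    exact (continuous_stdSimplex_apply _).comp h
  · have h : Continuous fun x : UninformedStrategy A B N × stdSimplex ℝ K ×
        InformedStrategy K A B N => x.1 t (ω.actions₁ t) (ω.actions₂ t) := by
      fun_prop
    exact (continuous_stdSimplex_apply _).comp h

end

end StochasticGame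

theorem mainTheorem11 {K A B : Type*} [Fintype K] [Fintype A] [Fintype B]
    [Nonempty K] [Nonempty A] [Nonempty B] (G : StochasticGame K A B)
    (N : ℕ) [NeZero N] (α : K → ℝ) :
    ∃ τ : StochasticGame.UninformedStrategy A B N,
      τ.DependsOnlyOnInformedActions ∧ G.IsDualSecurityStrategy α τ := by
  classical
  have : Nonempty (stdSimplex ℝ K) := ⟨⟨_, single_mem_stdSimplex ℝ (Classical.arbitrary K)⟩⟩
  have : Nonempty (stdSimplex ℝ A) := ⟨⟨_, single_mem_stdSimplex ℝ (Classical.arbitrary A)⟩⟩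
  have : Nonempty (stdSimplex ℝ B) := ⟨⟨_, single_mem_stdSimplex ℝ (Classical.arbitrary B)⟩⟩
  have hcont := G.continuous_dualPayoff (N := N) α
  let f (τ : StochasticGame.UninformedStrategy A B N)
      (x : stdSimplex ℝ K × StochasticGame.InformedStrategy K A B N) : ℝ :=
    G.dualPayoff α x.1 x.2 τ
  have hworst (τ) : G.IsWorstCost α τ (sSup (f τ '' Set.univ)) := by
    have := (isCompact_univ.image (hcont.comp (Continuous.prodMk_right τ))).isGreatest_sSup
      (Set.univ_nonempty.image _)
    rwa [StochasticGame.IsWorstCost, ← Set.image_univ]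
  -- The supremum of a jointly continuous function over a compact space is continuous in `τ`, so a
  -- minimizer exists.
  obtain ⟨τ, -, hτ⟩ := isCompact_univ.exists_isMinOn Set.univ_nonempty
    (isCompact_univ.continuous_sSup (f := f) hcont).continuousOn
  let τ' : StochasticGame.UninformedStrategy A B N :=
    fun t I _ => StochasticGame.marginal τ t I
  refine ⟨τ', fun _ _ _ _ => rfl, sSup (f τ' '' Set.univ), ⟨⟨τ', hworst τ'⟩, ?_⟩, hworst τ'⟩
  rintro u ⟨τ₁, hu⟩
  -- A best reply to `τ'` is converted into a reply to `τ` with the same `p` and equal payoff.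
  obtain ⟨⟨p, σ⟩, hpσ⟩ := (hworst τ').1
  obtain ⟨σ', hσ'⟩ := G.exists_dualPayoff_eq α p σ τ
  calc sSup (f τ' '' Set.univ) = G.dualPayoff α p σ' τ := hpσ.symm.trans hσ'
    _ ≤ sSup (f τ '' Set.univ) := (hworst τ).2 ⟨(p, σ'), rfl⟩
    _ ≤ sSup (f τ₁ '' Set.univ) := hτ (Set.mem_univ τ₁)
    _ = u := (hworst τ₁).unique hu
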